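/- **Setting.** Let $(\mathcal A,\rho)$ be a compact metric space of actions and $\mathcal O$ a (standard Borel) space of parameters. Let $\Theta\in\mathcal O$ have prior law $\mathbb P_\Theta$, let $\mathbb P_{R\mid A,\Theta}$ be the reward distribution, with finite mean $r(a,\theta)=\mathbb E[R(a,\theta)]$, and let $\pi_\star:\mathcal O\to\mathcal A$ be measurable with $\pi_\star(\theta)\in\arg\max_a r(a,\theta)$; put $A^\star=\pi_\star(\Theta)$. At each round $t=1,\dots,T$, Thompson Sampling draws $\hat\Theta_t$ from the posterior $\mathbb P_{\Theta\mid H^t}$ given the history $H^t$ of previous action-reward pairs, independently of $\Theta$ given $H^t$, plays $A_t=\pi_\star(\hat\Theta_t)$ and observes a reward $R_t$ of law $\mathbb P_{R\mid A,\Theta}(\cdot\mid A_t,\Theta)$. Its expected regret is $\mathbb E[\mathrm{Regret}(T)]=\mathbb E\big[\sum_{t=1}^T (r(A^\star,\Theta)-r(A_t,\Theta))\big]$. Write $\mathbb E_t$ and $\mathrm I_t$ for expectation and mutual information conditional on (the realization of) $H^t$. Let $\epsilon\ge 0$ be such that the covering number $\mathcal N=\mathcal N(\mathcal A,\rho,\epsilon)$,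 i.e. the smallest number of points of $\mathcal A$ such that every action is within distance $\epsilon$ of one of them, is finite. Let $q:\mathcal A\to\{1,\dots,\mathcal N\}$ be a measurable quantization of $\mathcal A$ on an $\epsilon$-net $c_1,\dots,c_{\mathcal N}$ of cardinality $\mathcal N$, that is, $\rho(a,c_{q(a)})\le\epsilon$ for all $a$. Put $A^\star_\epsilon=q(A^\star)$ and $\hat A_{t,\epsilon}=q(A_t)$. For a random function $\phi_t:\{1,\dots,\mathcal N\}\to\mathcal A$ whose law depends on $H^t$ and which is otherwise independent of the other variables, put $\tilde A^\star_t=\phi_t(A^\star_\epsilon)$ and $\tilde A_t=\phi_t(\hat A_{t,\epsilon})$. The family $(\phi_t)_{t\le T}$ is a *one-step compressed Thompson Sampling at level $\varepsilon$* if, for every $t\le T$, almost surely, 1. $\mathbb E_t[R(A^\star,\Theta)-R(A_t,\Theta)]\le\varepsilon+\mathbb E_t[R(\tilde A^\star_t,\Theta)-R(\tilde A_t,\Theta)]$; 2. $\mathrm I_t\big(A^\star_\epsilon;\tilde A_t,R(\tilde A_t,\Theta)\big)\le \mathrm I_t\big(A^\star_\epsilon;A_t,R(A_t,\Theta)\big)$.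 Its information ratio is $$\tilde\Gamma_t=\frac{\mathbb E_t[R(\tilde A^\star_t,\Theta)-R(\tilde A_t,\Theta)]^2}{\mathrm I_t\big(A^\star_\epsilon;\tilde A_t,R(\tilde A_t,\Theta)\big)}\in[0,\infty],$$ with $0/0=0$ and $x/0=\infty$ for $x>0$. **Corollary.** Assume that $a\mapsto r(a,\theta)$ is $L$-Lipschitz with respect to $\rho$ for every $\theta\in\mathcal O$. (i) Let $(\phi_t)$ be a one-step compressed Thompson Sampling at level $L\epsilon$ whose average expected information ratio satisfies $\frac1T\sum_{t=1}^T\mathbb E[\tilde\Gamma_t]\le\tilde\Gamma$ for some $\tilde\Gamma>0$. Then $$\mathbb E[\mathrm{Regret}(T)]\le\sqrt{\tilde\Gamma\,T\,\log\mathcal N(\mathcal A,\rho,\epsilon)}+L\epsilon T .$$ (ii) A one-step compressed Thompson Sampling at level $L\epsilon$ exists whenever the cells of $q$ have precision $L\epsilon$, that is, $r(\pi_\star(\theta),\theta)-r(a,\theta)\le L\epsilon$ for all $\theta\in\mathcal O$ and $a\in\mathcal A$ with $q(a)=q(\pi_\star(\theta))$. (iii) Without any condition on the cells, a one-step compressed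 Thompson Sampling at level $2L\epsilon$ exists, and for every such one with $\frac1T\sum_{t=1}^T\mathbb E[\tilde\Gamma_t]\le\tilde\Gamma$ for some $\tilde\Gamma>0$, $$\mathbb E[\mathrm{Regret}(T)]\le\sqrt{\tilde\Gamma\,T\,\log\mathcal N(\mathcal A,\rho,\epsilon)}+2L\epsilon T .$$ -/

import Mathlib

open MeasureTheory ProbabilityTheory
open scoped NNReal ENNReal

/-- A Bayesian bandit problem with action space `A` and parameter space `O`: a prior on the
parameter, the reward distribution given action and parameter, and a (measurable) choice `opt` of
an action maximizing the expected reward for each parameter. -/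
structure BanditProblem (A O : Type*) [MeasurableSpace A] [MeasurableSpace O] where
  /-- law of the parameter `Θ` -/
  prior : Measure O
  /-- law of the reward given (action, parameter) -/
  reward : Kernel (A × O) ℝ
  /-- the optimal policy `π⋆` -/
  opt : O → A
  prior_prob : IsProbabilityMeasure prior
  reward_markov : IsMarkovKernel reward
  reward_integrable : ∀ a θ, Integrable (fun x : ℝ => x) (reward (a, θ))
  opt_measurable : Measurable opt
  opt_optimal : ∀ a θ, ∫ x, x ∂(reward (a, θ)) ≤ ∫ x, x ∂(reward (opt θ, θ))

/-- Histories of length `t`: the first `t` action-reward pairs. -/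
abbrev History (A : Type*) (t : ℕ) : Type _ := Fin t → A × ℝ

/-- The mutual information `I(X; Y)` of a pair with joint law `ρ`. -/
noncomputable def mutualInfo {X Y : Type*} [MeasurableSpace X] [MeasurableSpace Y]
    (ρ : Measure (X × Y)) : ℝ≥0∞ :=
  InformationTheory.klDiv ρ (ρ.fst.prod ρ.snd)

namespace BanditProblem

variable {A O : Type*} [MeasurableSpace A] [MeasurableSpace O] (P : BanditProblem A O)

instance : IsProbabilityMeasure P.prior := P.prior_prob

instance : IsMarkovKernel P.reward := P.reward_markov

/-- The expected reward `E[R(a, θ)]`. -/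
noncomputable def meanReward (a : A) (θ : O) : ℝ := ∫ x, x ∂(P.reward (a, θ))

section ThompsonSampling

variable [StandardBorelSpace O] [Nonempty O]

/-- One round of Thompson Sampling. Given the joint law `m` of the parameter `θ` and the history
`h` before the round, draw `θ'` from the posterior of the parameter given `h`, play `opt θ'`, draw
the reward `x` from the law `reward (opt θ', θ)`, and append `(opt θ', x)` to the history. -/
noncomputable def step {t : ℕ} (m : ProbabilityMeasure (O × History A t)) :
    ProbabilityMeasure (O × History A (t + 1)) :=
  ⟨Measure.map
      (fun p : ((O × History A t) × O) × ℝ =>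
        (p.1.1.1, Fin.snoc (α := fun _ => A × ℝ) p.1.1.2 (P.opt p.1.2, p.2)))
      (((m : Measure (O × History A t)) ⊗ₘ
          ((condDistrib Prod.fst Prod.snd (m : Measure (O × History A t))).comap
            Prod.snd measurable_snd)) ⊗ₘ
        (P.reward.comap (fun p : (O × History A t) × O => (P.opt p.2, p.1.1))
          ((P.opt_measurable.comp measurable_snd).prodMk
            (measurable_fst.comp measurable_fst)))),
    Measure.isProbabilityMeasure_map (by
      have hopt := P.opt_measurable
      refine Measurable.aemeasurable (Measurable.prodMk (by fun_prop) ?_)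
      refine measurable_pi_lambda _ fun i => ?_
      refine Fin.lastCases ?_ (fun j => ?_) i
      · simp only [Fin.snoc_last]
        fun_prop
      · simp only [Fin.snoc_castSucc]
        fun_prop)⟩

/-- The joint law of the parameter and of the history of the first `t` rounds of Thompson
Sampling. -/
noncomputable def law : (t : ℕ) → ProbabilityMeasure (O × History A t)
  | 0 => ⟨P.prior.map (fun θ => (θ, Fin.elim0)),
      Measure.isProbabilityMeasure_map (by fun_prop)⟩
  | t + 1 => P.step (law t)

/-- The law of the history of the first `t` rounds. -/
noncomputable def historyLaw (t : ℕ) : Measure (History A t) :=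
  (P.law t : Measure (O × History A t)).snd

/-- The posterior distribution of the parameter given the history of the first `t` rounds. -/
noncomputable def posterior (t : ℕ) : Kernel (History A t) O :=
  condDistrib Prod.fst Prod.snd (P.law t : Measure (O × History A t))

/-- The expected (Bayesian) regret of `T` rounds of Thompson Sampling; the average over the reward
noise is taken first. -/
noncomputable def expectedRegret (T : ℕ) : ℝ :=
  ∫ p, ∑ s : Fin T, (P.meanReward (P.opt p.1) p.1 - P.meanReward (p.2 s).1 p.1)
    ∂(P.law T : Measure (O × History A T))

/-- The law, given the history `h`, of the action that Thompson Sampling plays next. -/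
noncomputable def actionLaw {t : ℕ} (h : History A t) : Measure A :=
  (P.posterior t h).map P.opt

/-- The regret of the next action of Thompson Sampling, conditional on the history `h`. -/
noncomputable def condRegret {t : ℕ} (h : History A t) : ℝ :=
  ∫ θ, (P.meanReward (P.opt θ) θ - ∫ a, P.meanReward a θ ∂(P.actionLaw h)) ∂(P.posterior t h)

variable {K : ℕ} (q : A → Fin K)

/-- The joint law of `(q A⋆, (A, R(A, Θ)))` conditional on the history `h`, where the action `A`
has law `α` and is drawn independently of `Θ`. -/
noncomputable def infoLaw {t : ℕ} (h : History A t) (α : Measure A) :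
    Measure (Fin K × (A × ℝ)) :=
  ((α.prod (P.posterior t h)) ⊗ₘ P.reward).map
    (fun p : (A × O) × ℝ => (q (P.opt p.1.2), (p.1.1, p.2)))

/-- `I_t(q A⋆; A, R(A, Θ))` conditional on the history `h`, for an action `A` of law `α` drawn
independently of `Θ`. -/
noncomputable def condInfo {t : ℕ} (h : History A t) (α : Measure A) : ℝ≥0∞ :=
  mutualInfo (P.infoLaw q h α)

/-- The law, given the history `h`, of the compressed action `φ(q Â)`, where `Â` is the action
that Thompson Sampling plays next. The random function `φ` is given by the law `φ (h, k)` of its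
value at the cell `k`, conditional on the history `h`. -/
noncomputable def compressedActionLaw {t : ℕ} (φ : Kernel (History A t × Fin K) A)
    (h : History A t) : Measure A :=
  ((P.actionLaw h).map q).bind (fun k => φ (h, k))

/-- The one-step regret `E_t[R(φ(q A⋆), Θ) - R(φ(q Â), Θ)]` of the compressed sampling, conditional
on the history `h`. -/
noncomputable def compressedRegret {t : ℕ} (φ : Kernel (History A t × Fin K) A)
    (h : History A t) : ℝ :=
  ∫ θ, ((∫ a, P.meanReward a θ ∂(φ (h, q (P.opt θ))))
      - ∫ a, P.meanReward a θ ∂(P.compressedActionLaw q φ h)) ∂(P.posterior t h)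

/-- The information ratio of the one-step compressed sampling given the history `h`. A ratio `0/0`
is `0`, and a positive number divided by `0` is `∞`. -/
noncomputable def infoRatio {t : ℕ} (φ : Kernel (History A t × Fin K) A)
    (h : History A t) : ℝ≥0∞ :=
  ENNReal.ofReal (P.compressedRegret q φ h ^ 2) /
    P.condInfo q h (P.compressedActionLaw q φ h)

/-- `φ` is a one-step compressed Thompson Sampling at level `ε` for the statistic `q A⋆`, over `T`
rounds: at each round its regret is `ε`-close to that of Thompson Sampling, and it reveals no more
information about the statistic than Thompson Sampling does. -/
structure IsCompressedTS (T : ℕ) (ε : ℝ)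
    (φ : (t : ℕ) → Kernel (History A t × Fin K) A) : Prop where
  markov : ∀ t < T, IsMarkovKernel (φ t)
  regret_le : ∀ t < T, ∀ᵐ h ∂(P.historyLaw t),
    P.condRegret h ≤ ε + P.compressedRegret q (φ t) h
  info_le : ∀ t < T, ∀ᵐ h ∂(P.historyLaw t),
    P.condInfo q h (P.compressedActionLaw q (φ t) h) ≤ P.condInfo q h (P.actionLaw h)

/-- The average over `T` rounds of the expected one-step compressed information ratio. -/
noncomputable def avgInfoRatio (T : ℕ)
    (φ : (t : ℕ) → Kernel (History A t × Fin K) A) : ℝ≥0∞ :=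
  (T : ℝ≥0∞)⁻¹ * ∑ t ∈ Finset.range T, ∫⁻ h, P.infoRatio q (φ t) h ∂(P.historyLaw t)

end ThompsonSampling

/-- The cells of the partition `{q = k}` have precision `ε`: replacing the action that is optimal
for some parameter by another action of its cell costs at most `ε` at that parameter. -/
def CellPrecision {K : ℕ} (q : A → Fin K) (ε : ℝ) : Prop :=
  ∀ θ a, q a = q (P.opt θ) → P.meanReward (P.opt θ) θ - P.meanReward a θ ≤ ε

end BanditProblem

/-- `q` is a measurable quantization of `A` on an `ϵ`-net (with `K` points `c k`) of the smallest
possible cardinality. -/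
structure IsMinimalQuantization {A : Type*} [MetricSpace A] [MeasurableSpace A] {K : ℕ} (ϵ : ℝ≥0)
    (c : Fin K → A) (q : A → Fin K) : Prop where
  card_eq : Metric.coveringNumber ϵ (Set.univ : Set A) = K
  measurable : Measurable q
  dist_le : ∀ a, dist a (c (q a)) ≤ ϵ

/-! Regret bound: in each round the conditional regret is at most `ε` plus the compressed regret
`c`. For every `l > 0`, AM-GM gives `c ≤ (l / 2) * (c ^ 2 / I) + I / (2 * l)`, where `I` is the
compressed information; `I` may then be replaced by the larger information revealed by Thompson
Sampling itself. Each round's information about `q A⋆` equals the expected drop of its posterior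
entropy, so the sum over rounds telescopes and is at most `log K` (`sum_lintegral_condInfo_le`).
Taking the infimum over `l` produces the square root.

Existence: let `φ` resample the Thompson action conditionally on its cell. Then `φ(q Â)` has the law
of `Â`, so the information is unchanged, and the only loss is the gap between `A⋆` and a random
action of its own cell. That gap is at most the precision of the cells, which the Lipschitz bound
makes at most `2 * L * ϵ` through the common centre. -/

/-- The Shannon entropy of a measure on a finite type. -/
noncomputable def discreteEntropy {X : Type*} [Fintype X] [MeasurableSpace X]
    (μ : Measure X) : ℝ :=
  ∑ x, Real.negMulLog (μ.real {x})

/-! ### Entropy and mutual information of a finite-valued variable. -/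

section DiscreteEntropy

variable {X Y : Type*} [Fintype X] [MeasurableSpace X] [MeasurableSpace Y]

/-- Jensen's inequality for the concave `negMulLog` with uniform weights. -/
lemma discreteEntropy_le_log_card [MeasurableSingletonClass X] (μ : Measure X)
    [IsProbabilityMeasure μ] : discreteEntropy μ ≤ Real.log (Fintype.card X) := by
  have : Nonempty X := nonempty_of_isProbabilityMeasure μ
  set n : ℝ := (Fintype.card X : ℝ) with hn
  have hn0 : 0 < n := by
    rw [hn]
    exact_mod_cast Fintype.card_pos
  have hsum : ∑ x, μ.real {x} = 1 := by
    simp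
  have h := Real.concaveOn_negMulLog.le_map_sum (t := (Finset.univ : Finset X))
    (w := fun _ => n⁻¹) (p := fun x => μ.real {x}) (fun _ _ => by positivity)
    (by simp [← hn, hn0.ne']) (fun _ _ => measureReal_nonneg)
  simp only [smul_eq_mul, ← Finset.mul_sum, hsum, mul_one] at h
  rw [Real.negMulLog, Real.log_inv, neg_mul_neg] at h
  exact le_of_mul_le_mul_left h (by positivity)

lemma measurable_discreteEntropy_kernel [MeasurableSingletonClass X] (κ : Kernel Y X) :
    Measurable fun y => discreteEntropy (κ y) := by
  unfold discreteEntropy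
  refine Finset.measurable_sum _ fun x _ => ?_
  exact Real.continuous_negMulLog.measurable.comp
    (κ.measurable_coe (measurableSet_singleton x)).ennreal_toReal

/-- The contribution of one value of a discrete variable to the identity
`I(X; Y) + H(X | Y) = H(X)`. -/
lemma lintegral_klFun_add_lintegral_negMulLog (ν : Measure Y) [IsProbabilityMeasure ν]
    {u : Y → ℝ} (hu : Measurable u) (hu0 : ∀ y, 0 ≤ u y) (hu1 : ∀ y, u y ≤ 1) {p : ℝ}
    (hp : ∫ y, u y ∂ν = p) :
    ENNReal.ofReal p * ∫⁻ y, ENNReal.ofReal (InformationTheory.klFun (u y / p)) ∂ν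
      + ∫⁻ y, ENNReal.ofReal (Real.negMulLog (u y)) ∂ν = ENNReal.ofReal (Real.negMulLog p) := by
  have hint : Integrable u ν := .of_bound hu.aestronglyMeasurable 1
    (.of_forall fun y => by rw [Real.norm_of_nonneg (hu0 y)]; exact hu1 y)
  have hp0 : 0 ≤ p := hp ▸ integral_nonneg hu0
  rcases hp0.eq_or_lt with rfl | hpos
  · have : u =ᵐ[ν] 0 := (integral_eq_zero_iff_of_nonneg hu0 hint).1 hp
    have h2 : ∫⁻ y, ENNReal.ofReal (Real.negMulLog (u y)) ∂ν = 0 := by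
      rw [lintegral_eq_zero_iff (by fun_prop)]
      filter_upwards [this] with y hy
      simp [hy]
    simp [h2]
  · have hm : Measurable fun y => InformationTheory.klFun (u y / p) :=
      InformationTheory.measurable_klFun.comp (hu.div_const p)
    rw [← lintegral_const_mul _ hm.ennreal_ofReal, ← lintegral_add_right _ (by fun_prop)]
    -- The terms `u log u` cancel, leaving an expression affine in `u`, whose integral depends on
    -- `p` only.
    have key : ∀ y, p * InformationTheory.klFun (u y / p) + Real.negMulLog (u y)
        = p - u y * (Real.log p + 1) := by
      intro y
      rw [InformationTheory.klFun_apply, Real.negMulLog]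
      rcases (hu0 y).eq_or_lt with h | h
      · simp [← h]
      · rw [Real.log_div h.ne' hpos.ne']
        field_simp
        ring
    have hkl : ∀ y, 0 ≤ p * InformationTheory.klFun (u y / p) := fun y =>
      mul_nonneg hp0 (InformationTheory.klFun_nonneg (div_nonneg (hu0 y) hp0))
    have hent : ∀ y, 0 ≤ Real.negMulLog (u y) := fun y => Real.negMulLog_nonneg (hu0 y) (hu1 y)
    have key' : ∀ y, ENNReal.ofReal p * ENNReal.ofReal (InformationTheory.klFun (u y / p))
        + ENNReal.ofReal (Real.negMulLog (u y)) = ENNReal.ofReal (p - u y * (Real.log p + 1)) := by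
      intro y
      rw [← ENNReal.ofReal_mul hp0, ← ENNReal.ofReal_add (hkl y) (hent y), key]
    simp_rw [key']
    have hi : Integrable (fun y => u y * (Real.log p + 1)) ν := hint.mul_const _
    have hpi : Integrable (fun y => p - u y * (Real.log p + 1)) ν := (integrable_const p).sub hi
    rw [← ofReal_integral_eq_lintegral_ofReal hpi
      (.of_forall fun y => (add_nonneg (hkl y) (hent y)).trans_eq (key y))]
    congr 1
    rw [integral_sub (integrable_const p) hi, integral_mul_const, hp]
    simp [Real.negMulLog]
    ring

variable [MeasurableSingletonClass X]

lemma measurable_kernel_singleton_div (κ : Kernel Y X) (μ : Measure X) :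
    Measurable fun z : X × Y => κ z.2 {z.1} / μ {z.1} := by
  refine measurable_from_prod_countable_right (f := fun z : X × Y => κ z.2 {z.1} / μ {z.1}) ?_
  intro x
  exact (κ.measurable_coe (measurableSet_singleton x)).div (measurable_const (a := μ {x}))

/-- Bayes' formula: the explicit density turns the divergence defining `mutualInfo` into a finite
sum over `X` of integrals over `Y`. -/
lemma map_swap_compProd_eq_withDensity (ν : Measure Y) [IsProbabilityMeasure ν]
    (κ : Kernel Y X) [IsMarkovKernel κ] :
    (ν ⊗ₘ κ).map Prod.swap
      = ((κ ∘ₘ ν).prod ν).withDensity fun z => κ z.2 {z.1} / (κ ∘ₘ ν) {z.1} := by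
  have hf := measurable_kernel_singleton_div κ (κ ∘ₘ ν)
  have hx : ∀ x, Measurable fun y => κ y {x} :=
    fun x => κ.measurable_coe (measurableSet_singleton x)
  refine Measure.ext_of_lintegral _ fun g hg => ?_
  have hgx : ∀ x, Measurable fun y => g (x, y) := fun x => hg.comp measurable_prodMk_left
  have hgs : Measurable fun z : Y × X => g z.swap := hg.comp measurable_swap
  rw [lintegral_map hg measurable_swap, Measure.lintegral_compProd hgs,
    lintegral_withDensity_eq_lintegral_mul _ hf hg, lintegral_prod _ (hf.mul hg).aemeasurable]
  simp only [Prod.swap_prod_mk, lintegral_fintype, Pi.mul_apply]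
  have hgm : ∀ x, Measurable fun y => g (x, y) * κ y {x} := fun x => (hgx x).mul (hx x)
  have hfm : ∀ x, Measurable fun y => κ y {x} / (κ ∘ₘ ν) {x} * g (x, y) :=
    fun x => ((hx x).div measurable_const).mul (hgx x)
  rw [lintegral_finsetSum _ fun x _ => hgm x]
  refine Finset.sum_congr rfl fun x _ => ?_
  have hp : (κ ∘ₘ ν) {x} = ∫⁻ y, κ y {x} ∂ν :=
    Measure.bind_apply (measurableSet_singleton x) κ.aemeasurable
  -- A value `x` of marginal mass zero has `κ y {x} = 0` for almost every `y`, so the quotient there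
  -- plays no role.
  by_cases h0 : (κ ∘ₘ ν) {x} = 0
  · rw [h0, mul_zero, lintegral_eq_zero_iff (hgm x)]
    rw [hp, lintegral_eq_zero_iff (hx x)] at h0
    filter_upwards [h0] with y hy
    simp_all
  · rw [mul_comm, ← lintegral_const_mul _ (hfm x)]
    refine lintegral_congr fun y => ?_
    rw [← mul_assoc, ENNReal.mul_div_cancel h0 (measure_ne_top _ _), mul_comm]

/-- `I(X; Y) + H(X | Y) = H(X)` for a discrete variable `X`, with `κ` the conditional law of `X`
given `Y`. -/
lemma mutualInfo_add_lintegral_discreteEntropy (ν : Measure Y) [IsProbabilityMeasure ν]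
    (κ : Kernel Y X) [IsMarkovKernel κ] :
    mutualInfo ((ν ⊗ₘ κ).map Prod.swap) + ∫⁻ y, ENNReal.ofReal (discreteEntropy (κ y)) ∂ν
      = ENNReal.ofReal (discreteEntropy (κ ∘ₘ ν)) := by
  have hf := measurable_kernel_singleton_div κ (κ ∘ₘ ν)
  have hfst : ((ν ⊗ₘ κ).map Prod.swap).fst = κ ∘ₘ ν := by
    rw [Measure.fst_map_swap, Measure.snd_compProd]
  have hsnd : ((ν ⊗ₘ κ).map Prod.swap).snd = ν := by
    rw [Measure.snd_map_swap, Measure.fst_compProd]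
  have hac : (ν ⊗ₘ κ).map Prod.swap ≪ (κ ∘ₘ ν).prod ν := by
    rw [map_swap_compProd_eq_withDensity]
    exact withDensity_absolutelyContinuous _ _
  have : IsProbabilityMeasure ((ν ⊗ₘ κ).map Prod.swap) :=
    Measure.isProbabilityMeasure_map measurable_swap.aemeasurable
  have hkl : mutualInfo ((ν ⊗ₘ κ).map Prod.swap)
      = ∑ x, ENNReal.ofReal ((κ ∘ₘ ν).real {x}) * ∫⁻ y, ENNReal.ofReal
          (InformationTheory.klFun ((κ y).real {x} / (κ ∘ₘ ν).real {x})) ∂ν := by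
    rw [mutualInfo, hfst, hsnd, InformationTheory.klDiv_eq_lintegral_klFun_of_ac hac]
    have hrn : ((ν ⊗ₘ κ).map Prod.swap).rnDeriv ((κ ∘ₘ ν).prod ν) =ᵐ[(κ ∘ₘ ν).prod ν]
        fun z => κ z.2 {z.1} / (κ ∘ₘ ν) {z.1} := by
      conv_lhs => rw [map_swap_compProd_eq_withDensity]
      exact Measure.rnDeriv_withDensity _ hf
    have : ∫⁻ z, ENNReal.ofReal (InformationTheory.klFun
          (((ν ⊗ₘ κ).map Prod.swap).rnDeriv ((κ ∘ₘ ν).prod ν) z).toReal) ∂((κ ∘ₘ ν).prod ν)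
        = ∫⁻ z, ENNReal.ofReal (InformationTheory.klFun
          (κ z.2 {z.1} / (κ ∘ₘ ν) {z.1}).toReal) ∂((κ ∘ₘ ν).prod ν) := by
      refine lintegral_congr_ae ?_
      filter_upwards [hrn] with z hz
      rw [hz]
    have hm : Measurable fun z : X × Y => ENNReal.ofReal (InformationTheory.klFun
        (κ z.2 {z.1} / (κ ∘ₘ ν) {z.1}).toReal) :=
      (InformationTheory.measurable_klFun.comp hf.ennreal_toReal).ennreal_ofReal
    rw [this, lintegral_prod _ hm.aemeasurable, lintegral_fintype]
    refine Finset.sum_congr rfl fun x _ => ?_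
    rw [ofReal_measureReal, mul_comm]
    simp only [ENNReal.toReal_div, measureReal_def]
  have hent : ∀ (μ : Measure X) [IsProbabilityMeasure μ], ENNReal.ofReal (discreteEntropy μ)
      = ∑ x, ENNReal.ofReal (Real.negMulLog (μ.real {x})) := fun μ _ =>
    ENNReal.ofReal_sum_of_nonneg fun _ _ =>
      Real.negMulLog_nonneg measureReal_nonneg measureReal_le_one
  have hm : ∀ x, Measurable fun y => (κ y).real {x} :=
    fun x => (κ.measurable_coe (measurableSet_singleton x)).ennreal_toReal
  rw [hkl, hent (κ ∘ₘ ν)]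
  simp_rw [hent]
  have hm' : ∀ x, Measurable fun y => ENNReal.ofReal (Real.negMulLog ((κ y).real {x})) :=
    fun x => (Real.continuous_negMulLog.measurable.comp (hm x)).ennreal_ofReal
  rw [lintegral_finsetSum _ fun x _ => hm' x, ← Finset.sum_add_distrib]
  refine Finset.sum_congr rfl fun x _ => ?_
  refine lintegral_klFun_add_lintegral_negMulLog ν (hm x) (fun _ => measureReal_nonneg)
    (fun _ => measureReal_le_one) ?_
  rw [measureReal_def, Measure.bind_apply (measurableSet_singleton x) κ.aemeasurable]
  exact integral_toReal (κ.measurable_coe (measurableSet_singleton x)).aemeasurable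
    (.of_forall fun y => measure_lt_top _ _)

end DiscreteEntropy

/-! ### The law of Thompson Sampling and the chain rule for information. -/

namespace BanditProblem

variable {A O : Type*} [MeasurableSpace A] [MeasurableSpace O] (P : BanditProblem A O)

lemma measurable_snoc {t : ℕ} :
    Measurable fun p : History A t × (A × ℝ) =>
      (Fin.snoc (α := fun _ => A × ℝ) p.1 p.2 : History A (t + 1)) := by
  refine measurable_pi_lambda _ fun i => ?_
  refine Fin.lastCases ?_ (fun j => ?_) i
  · simp only [Fin.snoc_last]
    fun_prop
  · simp only [Fin.snoc_castSucc]
    fun_prop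

lemma measurable_lintegral_reward {Y : Type*} [MeasurableSpace Y] {g : Y → A × O}
    (hg : Measurable g) {f : Y × ℝ → ℝ≥0∞} (hf : Measurable f) :
    Measurable fun y => ∫⁻ x, f (y, x) ∂(P.reward (g y)) := by
  simpa using hf.lintegral_kernel_prod_right' (κ := P.reward.comap g hg)

lemma measurable_cell_opt {K : ℕ} {q : A → Fin K} (hq : Measurable q) :
    Measurable fun θ => q (P.opt θ) :=
  hq.comp P.opt_measurable

section ThompsonSampling

variable [StandardBorelSpace O] [Nonempty O]

instance (t : ℕ) : IsProbabilityMeasure (P.historyLaw t) := by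
  unfold historyLaw
  infer_instance

instance (t : ℕ) : IsMarkovKernel (P.posterior t) := by
  unfold posterior
  infer_instance

instance {t : ℕ} (h : History A t) : IsProbabilityMeasure (P.actionLaw h) :=
  Measure.isProbabilityMeasure_map P.opt_measurable.aemeasurable

lemma law_eq_map_swap (t : ℕ) :
    (P.law t : Measure (O × History A t))
      = (P.historyLaw t ⊗ₘ P.posterior t).map Prod.swap := by
  rw [historyLaw, posterior, Measure.snd, compProd_map_condDistrib (by fun_prop),
    Measure.map_map measurable_swap (by fun_prop)]
  exact Measure.map_id.symm

lemma lintegral_law (t : ℕ) {f : O × History A t → ℝ≥0∞} (hf : Measurable f) :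
    ∫⁻ p, f p ∂(P.law t : Measure (O × History A t))
      = ∫⁻ h, ∫⁻ θ, f (θ, h) ∂(P.posterior t h) ∂(P.historyLaw t) := by
  have hfs : Measurable fun z : History A t × O => f z.swap := hf.comp measurable_swap
  rw [law_eq_map_swap, lintegral_map hf measurable_swap, Measure.lintegral_compProd hfs]
  rfl

/-- Given the history, the true parameter `θ` and the sampled one `θ'` are independent draws from
the same posterior; later computations use `step` only through this formula. -/
lemma lintegral_law_succ (t : ℕ) {f : O × History A (t + 1) → ℝ≥0∞} (hf : Measurable f) :
    ∫⁻ p, f p ∂(P.law (t + 1) : Measure (O × History A (t + 1)))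
      = ∫⁻ h, ∫⁻ θ, ∫⁻ θ', ∫⁻ x, f (θ, Fin.snoc (α := fun _ => A × ℝ) h (P.opt θ', x))
          ∂(P.reward (P.opt θ', θ)) ∂(P.posterior t h) ∂(P.posterior t h) ∂(P.historyLaw t) := by
  have hopt := P.opt_measurable
  have hm : Measurable fun p : ((O × History A t) × O) × ℝ =>
      (p.1.1.1, (Fin.snoc (α := fun _ => A × ℝ) p.1.1.2 (P.opt p.1.2, p.2) :
        History A (t + 1))) :=
    Measurable.prodMk (by fun_prop)
      (measurable_snoc.comp (f := fun p : ((O × History A t) × O) × ℝ =>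
        (p.1.1.2, (P.opt p.1.2, p.2))) (by fun_prop))
  have hfm := hf.comp hm
  simp only [Function.comp_def] at hfm
  have h1 : Measurable fun p : (O × History A t) × O =>
      ∫⁻ x, f (p.1.1, Fin.snoc (α := fun _ => A × ℝ) p.1.2 (P.opt p.2, x))
        ∂(P.reward (P.opt p.2, p.1.1)) :=
    P.measurable_lintegral_reward (by fun_prop) hfm
  have h2 : Measurable fun p : O × History A t =>
      ∫⁻ θ', ∫⁻ x, f (p.1, Fin.snoc (α := fun _ => A × ℝ) p.2 (P.opt θ', x))
        ∂(P.reward (P.opt θ', p.1)) ∂(P.posterior t p.2) := by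
    simpa using h1.lintegral_kernel_prod_right'
      (κ := (P.posterior t).comap (Prod.snd : O × History A t → _) measurable_snd)
  rw [← P.lintegral_law t h2]
  change ∫⁻ p, f p ∂(Measure.map _ _) = _
  rw [lintegral_map hf hm, Measure.lintegral_compProd hfm]
  exact Measure.lintegral_compProd h1

variable {K : ℕ} (q : A → Fin K)

lemma lintegral_infoLaw (hq : Measurable q) {t : ℕ} (h : History A t) (α : Measure A)
    [IsProbabilityMeasure α] {g : Fin K × (A × ℝ) → ℝ≥0∞} (hg : Measurable g) :
    ∫⁻ z, g z ∂(P.infoLaw q h α)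
      = ∫⁻ a, ∫⁻ θ, ∫⁻ x, g (q (P.opt θ), (a, x)) ∂(P.reward (a, θ)) ∂(P.posterior t h) ∂α := by
  have hopt := P.opt_measurable
  have hm : Measurable fun p : (A × O) × ℝ => (q (P.opt p.1.2), (p.1.1, p.2)) := by fun_prop
  have hgm := hg.comp hm
  simp only [Function.comp_def] at hgm
  rw [infoLaw, lintegral_map hg hm, Measure.lintegral_compProd hgm]
  exact lintegral_prod _ (P.measurable_lintegral_reward measurable_id hgm).aemeasurable

lemma lintegral_infoLaw_actionLaw (hq : Measurable q) {t : ℕ} (h : History A t)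
    {g : Fin K × (A × ℝ) → ℝ≥0∞} (hg : Measurable g) :
    ∫⁻ z, g z ∂(P.infoLaw q h (P.actionLaw h))
      = ∫⁻ θ, ∫⁻ θ', ∫⁻ x, g (q (P.opt θ), (P.opt θ', x))
          ∂(P.reward (P.opt θ', θ)) ∂(P.posterior t h) ∂(P.posterior t h) := by
  have hopt := P.opt_measurable
  have h1 : Measurable fun p : A × O =>
      ∫⁻ x, g (q (P.opt p.2), (p.1, x)) ∂(P.reward (p.1, p.2)) :=
    P.measurable_lintegral_reward measurable_id
      (f := fun p : (A × O) × ℝ => g (q (P.opt p.1.2), (p.1.1, p.2))) (by fun_prop)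
  have h2 : Measurable fun p : O × O =>
      ∫⁻ x, g (q (P.opt p.2), (P.opt p.1, x)) ∂(P.reward (P.opt p.1, p.2)) :=
    h1.comp (f := fun p : O × O => (P.opt p.1, p.2)) (by fun_prop)
  rw [P.lintegral_infoLaw q hq h _ hg, actionLaw, lintegral_map h1.lintegral_prod_right' hopt,
    lintegral_lintegral_swap h2.aemeasurable]

/-- The joint law of `(q A⋆, (A, R(A, Θ)))` given the history, for the next action `A` of Thompson
Sampling. -/
noncomputable def infoKernel (t : ℕ) : Kernel (History A t) (Fin K × (A × ℝ)) :=
  ((P.posterior t ×ₖ P.posterior t) ⊗ₖ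
    (P.reward.comap (fun z : History A t × (O × O) => (P.opt z.2.1, z.2.2))
      ((P.opt_measurable.comp (measurable_fst.comp measurable_snd)).prodMk
        (measurable_snd.comp measurable_snd)))).map
    (fun p : (O × O) × ℝ => (q (P.opt p.1.2), (P.opt p.1.1, p.2)))

/-- Presenting the laws `infoLaw` as one kernel supplies measurability in the history and gives
access to uniqueness of disintegrations. In the pair of posterior draws, the first determines the
action and the second is the true parameter. -/
lemma infoKernel_apply (hq : Measurable q) {t : ℕ} (h : History A t) :
    P.infoKernel q t h = P.infoLaw q h (P.actionLaw h) := by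
  have hopt := P.opt_measurable
  have hm : Measurable fun p : (O × O) × ℝ => (q (P.opt p.1.2), (P.opt p.1.1, p.2)) := by
    fun_prop
  refine Measure.ext_of_lintegral _ fun g hg => ?_
  have hgm := hg.comp hm
  simp only [Function.comp_def] at hgm
  have h2 : Measurable fun p : O × O =>
      ∫⁻ x, g (q (P.opt p.2), (P.opt p.1, x)) ∂(P.reward (P.opt p.1, p.2)) :=
    P.measurable_lintegral_reward (by fun_prop) hgm
  rw [P.lintegral_infoLaw_actionLaw q hq h hg, infoKernel, Kernel.map_apply _ hm,
    lintegral_map hg hm, Kernel.lintegral_compProd _ _ _ hgm, Kernel.prod_apply]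
  simp only [Kernel.comap_apply]
  rw [lintegral_lintegral_swap (f := fun θ θ' => ∫⁻ x, g (q (P.opt θ), (P.opt θ', x))
    ∂(P.reward (P.opt θ', θ))) (h2.comp measurable_swap).aemeasurable]
  exact lintegral_prod _ h2.aemeasurable

lemma isMarkovKernel_infoKernel (hq : Measurable q) (t : ℕ) :
    IsMarkovKernel (P.infoKernel q t) :=
  Kernel.IsMarkovKernel.map _ (by have hopt := P.opt_measurable; fun_prop)

lemma lintegral_historyLaw_succ (hq : Measurable q) (t : ℕ) {f : History A (t + 1) → ℝ≥0∞}
    (hf : Measurable f) :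
    ∫⁻ h, f h ∂(P.historyLaw (t + 1))
      = ∫⁻ h, ∫⁻ y, f (Fin.snoc (α := fun _ => A × ℝ) h y)
          ∂(P.infoLaw q h (P.actionLaw h)).snd ∂(P.historyLaw t) := by
  have hfs : Measurable fun p : O × History A (t + 1) => f p.2 := hf.comp measurable_snd
  rw [historyLaw, Measure.snd, lintegral_map hf measurable_snd, P.lintegral_law_succ t hfs]
  refine lintegral_congr fun h => ?_
  have hfh : Measurable fun y : A × ℝ => f (Fin.snoc (α := fun _ => A × ℝ) h y) :=
    hf.comp (measurable_snoc.comp measurable_prodMk_left)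
  have hfhs : Measurable fun z : Fin K × (A × ℝ) => f (Fin.snoc (α := fun _ => A × ℝ) h z.2) :=
    hfh.comp measurable_snd
  rw [Measure.snd, lintegral_map hfh measurable_snd,
    P.lintegral_infoLaw_actionLaw q hq h hfhs]

/-- The law of `q A⋆` given the history of the next round, as a function of the present history and
of the next action-reward pair. -/
noncomputable def nextCellKernel (t : ℕ) : Kernel (History A t × (A × ℝ)) (Fin K) :=
  ((P.posterior (t + 1)).map (fun θ => q (P.opt θ))).comap _ measurable_snoc

lemma isMarkovKernel_nextCellKernel (hq : Measurable q) (t : ℕ) :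
    IsMarkovKernel (P.nextCellKernel q t) := by
  have := Kernel.IsMarkovKernel.map (P.posterior (t + 1)) (P.measurable_cell_opt hq)
  exact Kernel.IsMarkovKernel.comap _ _

/-- The entropy of `q A⋆` given the history. -/
noncomputable def cellEntropy {t : ℕ} (h : History A t) : ℝ≥0∞ :=
  ENNReal.ofReal (discreteEntropy ((P.posterior t h).map fun θ => q (P.opt θ)))

lemma measurable_cellEntropy (hq : Measurable q) (t : ℕ) :
    Measurable (P.cellEntropy q (t := t)) := by
  have := (measurable_discreteEntropy_kernel
    ((P.posterior t).map fun θ => q (P.opt θ))).ennreal_ofReal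
  simp only [Kernel.map_apply _ (P.measurable_cell_opt hq)] at this
  exact this

lemma cellEntropy_le (hq : Measurable q) {t : ℕ} (h : History A t) :
    P.cellEntropy q h ≤ ENNReal.ofReal (Real.log K) := by
  have := Measure.isProbabilityMeasure_map (μ := P.posterior t h)
    (P.measurable_cell_opt hq).aemeasurable
  refine ENNReal.ofReal_le_ofReal ?_
  simpa using discreteEntropy_le_log_card ((P.posterior t h).map fun θ => q (P.opt θ))

variable [MeasurableSpace.CountablyGenerated A]

/-- Consistency of successive posteriors. Each `posterior t` is a separate conditional distribution,
so Bayesian updating holds only almost surely: both kernels disintegrate the joint law of the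
history, the next action-reward pair and the cell of `A⋆`, and hence agree almost everywhere.
Countable generation of `A` serves this uniqueness. -/
lemma ae_infoKernel_map_swap_eq (hq : Measurable q) (t : ℕ) :
    ∀ᵐ h ∂(P.historyLaw t), ((P.infoKernel q t).map Prod.swap) h
      = ((P.infoKernel q t).snd ⊗ₖ P.nextCellKernel q t) h := by
  have hopt := P.opt_measurable
  have := P.isMarkovKernel_infoKernel q hq t
  have := P.isMarkovKernel_nextCellKernel q hq t
  have := Kernel.IsMarkovKernel.map (P.infoKernel q t) measurable_swap
  refine Kernel.ae_eq_of_compProd_eq (Measure.ext_of_lintegral _ fun f hf => ?_)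
  rw [Measure.lintegral_compProd hf, Measure.lintegral_compProd hf]
  have hf' : Measurable fun p : O × History A (t + 1) =>
      f (Fin.init p.2, (p.2 (Fin.last t), q (P.opt p.1))) :=
    hf.comp ((measurable_pi_lambda _ fun i => by unfold Fin.init; fun_prop).prodMk (by fun_prop))
  have hG : Measurable fun h : History A (t + 1) =>
      ∫⁻ θ, f (Fin.init h, (h (Fin.last t), q (P.opt θ))) ∂(P.posterior (t + 1) h) :=
    (hf'.comp measurable_swap).lintegral_kernel_prod_right' (κ := P.posterior (t + 1))
  -- The joint law after the round is disintegrated in two ways: over the history before it, and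
  -- over the history after it.
  trans ∫⁻ p, f (Fin.init p.2, (p.2 (Fin.last t), q (P.opt p.1)))
      ∂(P.law (t + 1) : Measure (O × History A (t + 1)))
  · rw [P.lintegral_law_succ t hf']
    refine lintegral_congr fun h => ?_
    have hfh : Measurable fun z : (A × ℝ) × Fin K => f (h, z) := hf.comp measurable_prodMk_left
    have hfhs : Measurable fun z : Fin K × (A × ℝ) => f (h, z.swap) := hfh.comp measurable_swap
    rw [Kernel.map_apply _ measurable_swap, lintegral_map hfh measurable_swap,
      P.infoKernel_apply q hq, P.lintegral_infoLaw_actionLaw q hq h hfhs]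
    simp
  · rw [P.lintegral_law _ hf', P.lintegral_historyLaw_succ q hq t hG]
    refine lintegral_congr fun h => ?_
    have hfh : Measurable fun z : (A × ℝ) × Fin K => f (h, z) := hf.comp measurable_prodMk_left
    rw [Kernel.lintegral_compProd _ _ _ hfh, Kernel.snd_apply, P.infoKernel_apply q hq]
    refine lintegral_congr fun y => ?_
    have hfy : Measurable fun k => f (h, (y, k)) := hfh.comp measurable_prodMk_left
    rw [nextCellKernel, Kernel.comap_apply, Kernel.map_apply _ (P.measurable_cell_opt hq),
      lintegral_map hfy (P.measurable_cell_opt hq)]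
    simp

/-- One link of the chain rule: `I(X; Y) + H(X | Y) = H(X)`, with `X` the cell of `A⋆` and `Y` the
next action-reward pair, under the conditional law given `h`. -/
lemma condInfo_add_lintegral_cellEntropy (hq : Measurable q) (t : ℕ) :
    ∀ᵐ h ∂(P.historyLaw t), P.condInfo q h (P.actionLaw h)
        + ∫⁻ y, P.cellEntropy q (Fin.snoc (α := fun _ => A × ℝ) h y : History A (t + 1))
          ∂(P.infoLaw q h (P.actionLaw h)).snd
      = P.cellEntropy q h := by
  have hopt := P.opt_measurable
  have := P.isMarkovKernel_infoKernel q hq t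
  have := P.isMarkovKernel_nextCellKernel q hq t
  filter_upwards [P.ae_infoKernel_map_swap_eq q hq t] with h hh
  rw [Kernel.map_apply _ measurable_swap, Kernel.compProd_apply_eq_compProd_sectR,
    Kernel.snd_apply, P.infoKernel_apply q hq, ← Measure.snd] at hh
  have hprob : IsProbabilityMeasure (P.infoLaw q h (P.actionLaw h)) := by
    rw [← P.infoKernel_apply q hq]
    infer_instance
  set W := P.infoLaw q h (P.actionLaw h) with hW
  have hW' : W = (W.snd ⊗ₘ (P.nextCellKernel q t).sectR h).map Prod.swap := by
    rw [← hh, Measure.map_map measurable_swap measurable_swap]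
    exact Measure.map_id.symm
  -- Averaging the updated law of the cell over the next observation gives back its present law.
  have hfst : (P.nextCellKernel q t).sectR h ∘ₘ W.snd
      = (P.posterior t h).map fun θ => q (P.opt θ) := by
    rw [← Measure.snd_compProd, ← hh, Measure.snd_map_swap]
    refine Measure.ext_of_lintegral _ fun g hg => ?_
    have hgf : Measurable fun z : Fin K × (A × ℝ) => g z.1 := hg.comp measurable_fst
    rw [Measure.fst, lintegral_map hg measurable_fst, hW,
      P.lintegral_infoLaw_actionLaw q hq h hgf,
      lintegral_map hg (P.measurable_cell_opt hq)]
    simp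
  have key := mutualInfo_add_lintegral_discreteEntropy W.snd ((P.nextCellKernel q t).sectR h)
  rw [← hW', hfst] at key
  rw [condInfo, ← hW, cellEntropy, ← key]
  congr 1
  refine lintegral_congr fun y => ?_
  rw [cellEntropy, Kernel.sectR_apply, nextCellKernel, Kernel.comap_apply,
    Kernel.map_apply _ (P.measurable_cell_opt hq)]

/-- Measurability of a divergence in the history is obtained indirectly: almost everywhere it is a
difference of two measurable finite entropies. -/
lemma aemeasurable_condInfo_actionLaw (hq : Measurable q) (t : ℕ) :
    AEMeasurable (fun h => P.condInfo q h (P.actionLaw h)) (P.historyLaw t) := by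
  have := P.isMarkovKernel_infoKernel q hq t
  have hm : Measurable fun h : History A t =>
      ∫⁻ y, P.cellEntropy q (Fin.snoc (α := fun _ => A × ℝ) h y : History A (t + 1))
        ∂(P.infoLaw q h (P.actionLaw h)).snd := by
    have := ((P.measurable_cellEntropy q hq (t + 1)).comp
      measurable_snoc).lintegral_kernel_prod_right' (κ := (P.infoKernel q t).snd)
    simp only [Kernel.snd_apply, P.infoKernel_apply q hq] at this
    exact this
  refine ⟨_, (P.measurable_cellEntropy q hq t).sub hm, ?_⟩
  filter_upwards [P.condInfo_add_lintegral_cellEntropy q hq t] with h hh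
  refine ENNReal.eq_sub_of_add_eq (ne_top_of_le_ne_top ENNReal.ofReal_ne_top
    (le_trans ?_ (P.cellEntropy_le q hq h))) hh
  exact hh ▸ le_add_self

lemma ae_condInfo_actionLaw_ne_top (hq : Measurable q) (t : ℕ) :
    ∀ᵐ h ∂(P.historyLaw t), P.condInfo q h (P.actionLaw h) ≠ ∞ := by
  filter_upwards [P.condInfo_add_lintegral_cellEntropy q hq t] with h hh
  refine ne_top_of_le_ne_top ENNReal.ofReal_ne_top (le_trans ?_ (P.cellEntropy_le q hq h))
  exact hh ▸ le_self_add

/-- The chain rule for the information that Thompson Sampling collects about `q A⋆`. -/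
lemma sum_lintegral_condInfo_add (hq : Measurable q) (T : ℕ) :
    ∑ t ∈ Finset.range T, ∫⁻ h, P.condInfo q h (P.actionLaw h) ∂(P.historyLaw t)
        + ∫⁻ h, P.cellEntropy q h ∂(P.historyLaw T)
      = ∫⁻ h, P.cellEntropy q h ∂(P.historyLaw 0) := by
  induction T with
  | zero => simp
  | succ T ih =>
    rw [Finset.sum_range_succ, add_assoc, ← ih,
      P.lintegral_historyLaw_succ q hq T (P.measurable_cellEntropy q hq (T + 1)),
      ← lintegral_add_left' (P.aemeasurable_condInfo_actionLaw q hq T)]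
    congr 1
    exact lintegral_congr_ae (P.condInfo_add_lintegral_cellEntropy q hq T)

lemma sum_lintegral_condInfo_le (hq : Measurable q) (T : ℕ) :
    ∑ t ∈ Finset.range T, ∫⁻ h, P.condInfo q h (P.actionLaw h) ∂(P.historyLaw t)
      ≤ ENNReal.ofReal (Real.log K) := by
  refine le_self_add.trans ((P.sum_lintegral_condInfo_add q hq T).le.trans ?_)
  refine (lintegral_mono fun h => P.cellEntropy_le q hq h).trans ?_
  simp

end ThompsonSampling

end BanditProblem

/-! ### AM-GM with a free parameter, and its optimization. -/

lemma le_sqrt_mul_of_forall_pos {x a b : ℝ} (ha : 0 ≤ a) (hb : 0 ≤ b)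
    (h : ∀ l : ℝ, 0 < l → x ≤ l / 2 * a + 1 / (2 * l) * b) : x ≤ √(a * b) := by
  -- The minimizer `l = √(b / a)` degenerates when `a` or `b` vanishes, so both are shifted by `δ`,
  -- which then tends to `0`.
  have key : ∀ δ : ℝ, 0 < δ → x ≤ √((a + δ) * (b + δ)) := by
    intro δ hδ
    have hA : 0 < √(a + δ) := Real.sqrt_pos.2 (by positivity)
    have hB : 0 < √(b + δ) := Real.sqrt_pos.2 (by positivity)
    have hA2 : √(a + δ) ^ 2 = a + δ := Real.sq_sqrt (by positivity)
    have hB2 : √(b + δ) ^ 2 = b + δ := Real.sq_sqrt (by positivity)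
    have hl : 0 < √(b + δ) / √(a + δ) := by positivity
    calc x ≤ √(b + δ) / √(a + δ) / 2 * a + 1 / (2 * (√(b + δ) / √(a + δ))) * b := h _ hl
      _ ≤ √(b + δ) / √(a + δ) / 2 * (a + δ) + 1 / (2 * (√(b + δ) / √(a + δ))) * (b + δ) := by
          gcongr <;> linarith
      _ = √(b + δ) / √(a + δ) / 2 * √(a + δ) ^ 2
            + 1 / (2 * (√(b + δ) / √(a + δ))) * √(b + δ) ^ 2 := by rw [hA2, hB2]
      _ = √(a + δ) * √(b + δ) := by
          field_simp
          ring
      _ = √((a + δ) * (b + δ)) := (Real.sqrt_mul (by positivity) _).symm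
  have ht : Filter.Tendsto (fun δ : ℝ => √((a + δ) * (b + δ))) (nhdsWithin 0 (Set.Ioi 0))
      (nhds (√((a + 0) * (b + 0)))) :=
    (Continuous.tendsto (by fun_prop) 0).mono_left nhdsWithin_le_nhds
  simp only [add_zero] at ht
  exact ge_of_tendsto ht (eventually_mem_nhdsWithin.mono fun δ hδ => key δ hδ)

lemma ofReal_le_mul_ratio_add_mul {c l : ℝ} (hl : 0 < l) {I J : ℝ≥0∞} (hIJ : I ≤ J)
    (hJ : J ≠ ∞) :
    ENNReal.ofReal c ≤ ENNReal.ofReal (l / 2) * (ENNReal.ofReal (c ^ 2) / I)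
      + ENNReal.ofReal (1 / (2 * l)) * J := by
  rcases le_or_gt c 0 with hc | hc
  · simp [ENNReal.ofReal_of_nonpos hc]
  -- With `c > 0` and `I = 0` the ratio is `∞` and the bound is trivial.
  rcases eq_or_ne I 0 with rfl | hI
  · have h1 : ENNReal.ofReal (c ^ 2) ≠ 0 := by simpa using hc.ne'
    have h2 : ENNReal.ofReal (l / 2) ≠ 0 := by simpa using hl
    rw [ENNReal.div_zero h1, ENNReal.mul_top h2, top_add]
    exact le_top
  have hIt : I ≠ ∞ := ne_top_of_le_ne_top hJ hIJ
  obtain ⟨i, hi, rfl⟩ : ∃ i : ℝ, 0 < i ∧ ENNReal.ofReal i = I :=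
    ⟨I.toReal, ENNReal.toReal_pos hI hIt, ENNReal.ofReal_toReal hIt⟩
  refine le_trans ?_ (add_le_add_right (mul_le_mul_right hIJ _) _)
  rw [← ENNReal.ofReal_div_of_pos hi, ← ENNReal.ofReal_mul (by positivity),
    ← ENNReal.ofReal_mul (by positivity), ← ENNReal.ofReal_add (by positivity) (by positivity)]
  refine ENNReal.ofReal_le_ofReal ?_
  -- AM-GM by completing the square.
  have : l / 2 * (c ^ 2 / i) + 1 / (2 * l) * i - c = (l * c - i) ^ 2 / (2 * l * i) := by
    field_simp
    ring
  have h2 : 0 ≤ (l * c - i) ^ 2 / (2 * l * i) := by positivity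
  linarith

/-! ### Gaps, and resampling the action inside its cell. -/

namespace BanditProblem

variable {A O : Type*} [MeasurableSpace A] [MeasurableSpace O] (P : BanditProblem A O)

/-- The loss of mean reward from playing `a` instead of the optimal action for `θ`. -/
noncomputable def gap (θ : O) (a : A) : ℝ := P.meanReward (P.opt θ) θ - P.meanReward a θ

lemma gap_nonneg (θ : O) (a : A) : 0 ≤ P.gap θ a := sub_nonneg.2 (P.opt_optimal a θ)

lemma measurable_meanReward : Measurable fun p : A × O => P.meanReward p.1 p.2 :=
  (measurable_snd.stronglyMeasurable.integral_kernel_prod_right'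
    (κ := P.reward) (f := fun p : (A × O) × ℝ => p.2)).measurable

lemma measurable_gap : Measurable fun p : O × A => P.gap p.1 p.2 := by
  have h := P.measurable_meanReward
  have hopt := P.opt_measurable
  exact (h.comp (f := fun p : O × A => (P.opt p.1, p.1)) (by fun_prop)).sub
    (h.comp measurable_swap)

section ThompsonSampling

variable {P} [StandardBorelSpace O] [Nonempty O] {K : ℕ} {q : A → Fin K}

lemma sum_lintegral_infoRatio_le {T : ℕ} {φ : (t : ℕ) → Kernel (History A t × Fin K) A}
    {Γ : ℝ} (h : P.avgInfoRatio q T φ ≤ ENNReal.ofReal Γ) :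
    ∑ t ∈ Finset.range T, ∫⁻ h, P.infoRatio q (φ t) h ∂(P.historyLaw t)
      ≤ ENNReal.ofReal (T * Γ) := by
  rcases eq_or_ne T 0 with rfl | hT
  · simp
  · rw [ENNReal.ofReal_mul (by positivity), ENNReal.ofReal_natCast]
    rwa [avgInfoRatio, mul_comm, ← div_eq_mul_inv, ENNReal.div_le_iff (by simpa using hT)
      (by simp), mul_comm] at h

/-- The law of the next action of Thompson Sampling given the history and given its cell. -/
noncomputable def cellActionKernel (hq : Measurable q) (t : ℕ) :
    Kernel (History A t × Fin K) A where
  toFun p := open Classical in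
    -- Conditioning on a null cell would give the zero measure; the fallback keeps the kernel
    -- Markov. The choice is harmless, since `A⋆` and `Â` have the same law given the history and
    -- almost surely avoid such cells.
    if P.actionLaw p.1 (q ⁻¹' {p.2}) = 0 then P.actionLaw p.1
      else (P.actionLaw p.1)[|q ⁻¹' {p.2}]
  measurable' := by
    have hα : ∀ s, MeasurableSet s → Measurable fun h : History A t => P.actionLaw h s := by
      intro s hs
      have := ((P.posterior t).map P.opt).measurable_coe hs
      simp only [Kernel.map_apply _ P.opt_measurable] at this
      exact this
    refine measurable_from_prod_countable_left fun k => ?_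
    have hk : MeasurableSet (q ⁻¹' {k}) := hq (measurableSet_singleton k)
    refine Measure.measurable_of_measurable_coe _ fun s hs => ?_
    have : ∀ h : History A t, (if P.actionLaw h (q ⁻¹' {k}) = 0 then P.actionLaw h
        else (P.actionLaw h)[|q ⁻¹' {k}]) s = if P.actionLaw h (q ⁻¹' {k}) = 0
          then P.actionLaw h s
          else (P.actionLaw h (q ⁻¹' {k}))⁻¹ * P.actionLaw h (q ⁻¹' {k} ∩ s) := by
      intro h
      split_ifs
      · rfl
      · exact cond_apply hk _ _
    simp only [this]
    exact Measurable.ite (hα _ hk (measurableSet_singleton 0)) (hα s hs)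
      ((hα _ hk).inv.mul (hα _ (hk.inter hs)))

instance (hq : Measurable q) (t : ℕ) : IsMarkovKernel (P.cellActionKernel hq t) where
  isProbabilityMeasure p := by
    change IsProbabilityMeasure (ite _ _ _)
    split_ifs with h
    · infer_instance
    · exact cond_isProbabilityMeasure h

lemma cellActionKernel_apply (hq : Measurable q) {t : ℕ} {h : History A t} {k : Fin K}
    (hk : P.actionLaw h (q ⁻¹' {k}) ≠ 0) :
    P.cellActionKernel hq t (h, k) = (P.actionLaw h)[|q ⁻¹' {k}] :=
  if_neg hk

/-- Law of total probability over the cells. -/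
lemma compressedActionLaw_cellActionKernel (hq : Measurable q) {t : ℕ} (h : History A t) :
    P.compressedActionLaw q (P.cellActionKernel hq t) h = P.actionLaw h := by
  conv_rhs => rw [← sum_meas_smul_cond_fiber hq (P.actionLaw h)]
  ext s hs
  have hm : Measurable fun k => P.cellActionKernel hq t (h, k) :=
    (P.cellActionKernel hq t).measurable.comp measurable_prodMk_left
  rw [compressedActionLaw, Measure.bind_apply hs hm.aemeasurable, lintegral_fintype,
    Measure.finsetSum_apply]
  refine Finset.sum_congr rfl fun k _ => ?_
  rw [Measure.map_apply hq (measurableSet_singleton k), Measure.smul_apply, smul_eq_mul, mul_comm]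
  by_cases hk : P.actionLaw h (q ⁻¹' {k}) = 0
  · simp [hk]
  · rw [cellActionKernel_apply hq hk]

end ThompsonSampling

/-! ### Lipschitz rewards: the regret bound and the existence of a compression. -/

section Lipschitz

variable {A O : Type*} [MetricSpace A] [MeasurableSpace A] [MeasurableSpace O]
  {P : BanditProblem A O} {L : ℝ≥0} {K : ℕ} {q : A → Fin K}

/-- Two actions of one cell are both within `ϵ` of its centre, hence within `2 * ϵ` of each other.
-/
lemma cellPrecision_two_mul (hLip : ∀ θ, LipschitzWith L (fun a => P.meanReward a θ)) {ϵ : ℝ≥0}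
    {c : Fin K → A} (hq : ∀ a, dist a (c (q a)) ≤ ϵ) : P.CellPrecision q (2 * L * ϵ) := by
  intro θ a ha
  have h1 := (hLip θ).dist_le_mul (P.opt θ) a
  have h2 := dist_triangle_right (P.opt θ) a (c (q a))
  have h3 := hq a
  have h4 := hq (P.opt θ)
  rw [← ha] at h4
  calc P.meanReward (P.opt θ) θ - P.meanReward a θ
      ≤ dist (P.meanReward (P.opt θ) θ) (P.meanReward a θ) := le_abs_self _
    _ ≤ L * dist (P.opt θ) a := h1
    _ ≤ L * (ϵ + ϵ) := by gcongr; linarith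
    _ = 2 * L * ϵ := by ring

variable [CompactSpace A]

/-- Compactness makes the gaps uniformly bounded, which yields the integrability of the gaps used
below. -/
lemma gap_le (hLip : ∀ θ, LipschitzWith L (fun a => P.meanReward a θ)) (θ : O) (a : A) :
    P.gap θ a ≤ L * Metric.diam (Set.univ : Set A) := by
  have h1 := (hLip θ).dist_le_mul (P.opt θ) a
  have h2 : dist (P.opt θ) a ≤ Metric.diam (Set.univ : Set A) :=
    Metric.dist_le_diam_of_mem isCompact_univ.isBounded (Set.mem_univ _) (Set.mem_univ _)
  calc P.gap θ a ≤ dist (P.meanReward (P.opt θ) θ) (P.meanReward a θ) := le_abs_self _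
    _ ≤ L * dist (P.opt θ) a := h1
    _ ≤ _ := by gcongr

lemma integrable_gap (hLip : ∀ θ, LipschitzWith L (fun a => P.meanReward a θ))
    {Y : Type*} [MeasurableSpace Y] (μ : Measure Y) [IsFiniteMeasure μ] {f : Y → O × A}
    (hf : Measurable f) : Integrable (fun y => P.gap (f y).1 (f y).2) μ :=
  .of_bound (P.measurable_gap.comp hf).aestronglyMeasurable _
    (.of_forall fun y => by
      rw [Real.norm_of_nonneg (P.gap_nonneg _ _)]
      exact gap_le hLip _ _)

lemma integrable_integral_gap (hLip : ∀ θ, LipschitzWith L (fun a => P.meanReward a θ))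
    (η : Kernel O A) [IsMarkovKernel η] (μ : Measure O) [IsFiniteMeasure μ] :
    Integrable (fun θ => ∫ a, P.gap θ a ∂(η θ)) μ := by
  refine .of_bound (C := L * Metric.diam (Set.univ : Set A))
    (P.measurable_gap.stronglyMeasurable.integral_kernel_prod_right' (κ := η)).aestronglyMeasurable
    (.of_forall fun θ => ?_)
  have := norm_integral_le_of_norm_le_const (μ := η θ) (f := fun a => P.gap θ a)
    (C := L * Metric.diam (Set.univ : Set A)) (.of_forall fun a => by
      rw [Real.norm_of_nonneg (P.gap_nonneg _ _)]
      exact gap_le hLip _ _)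
  simpa using this

variable [BorelSpace A]

lemma sub_integral_meanReward (hLip : ∀ θ, LipschitzWith L (fun a => P.meanReward a θ)) (θ : O)
    (μ : Measure A) [IsProbabilityMeasure μ] :
    P.meanReward (P.opt θ) θ - ∫ a, P.meanReward a θ ∂μ = ∫ a, P.gap θ a ∂μ := by
  have hint : Integrable (fun a => P.meanReward a θ) μ :=
    (hLip θ).continuous.integrable_of_hasCompactSupport (.of_compactSpace _)
  unfold gap
  rw [integral_sub (integrable_const _) hint]
  simp

variable [StandardBorelSpace O] [Nonempty O]

lemma condRegret_eq (hLip : ∀ θ, LipschitzWith L (fun a => P.meanReward a θ)) {t : ℕ}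
    (h : History A t) :
    P.condRegret h = ∫ θ, ∫ a, P.gap θ a ∂(P.actionLaw h) ∂(P.posterior t h) := by
  unfold condRegret
  simp_rw [sub_integral_meanReward hLip]

lemma ofReal_condRegret (hLip : ∀ θ, LipschitzWith L (fun a => P.meanReward a θ)) {t : ℕ}
    (h : History A t) :
    ENNReal.ofReal (P.condRegret h)
      = ∫⁻ θ, ∫⁻ θ', ENNReal.ofReal (P.gap θ (P.opt θ')) ∂(P.posterior t h)
          ∂(P.posterior t h) := by
  have hint : Integrable (fun θ => ∫ a, P.gap θ a ∂(P.actionLaw h)) (P.posterior t h) :=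
    integrable_integral_gap hLip (Kernel.const O (P.actionLaw h)) _
  rw [condRegret_eq hLip, ofReal_integral_eq_lintegral_ofReal hint
    (.of_forall fun θ => integral_nonneg fun a => P.gap_nonneg θ a)]
  refine lintegral_congr fun θ => ?_
  have hm : Measurable fun a => P.gap θ a := P.measurable_gap.comp measurable_prodMk_left
  rw [ofReal_integral_eq_lintegral_ofReal
    (integrable_gap hLip _ (f := fun a => (θ, a)) measurable_prodMk_left)
    (.of_forall fun a => P.gap_nonneg θ a), actionLaw,
    lintegral_map hm.ennreal_ofReal P.opt_measurable]

/-- Tower property by induction: appending a round leaves the earlier gaps unchanged, and the new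
gap averages to the conditional regret. -/
lemma lintegral_sum_gap (hLip : ∀ θ, LipschitzWith L (fun a => P.meanReward a θ)) (T : ℕ) :
    ∫⁻ p, ∑ s : Fin T, ENNReal.ofReal (P.gap p.1 (p.2 s).1)
        ∂(P.law T : Measure (O × History A T))
      = ∑ t ∈ Finset.range T, ∫⁻ h, ENNReal.ofReal (P.condRegret h) ∂(P.historyLaw t) := by
  have hopt := P.opt_measurable
  have hg := P.measurable_gap.ennreal_ofReal
  have hS : ∀ T : ℕ, Measurable fun p : O × History A T =>
      ∑ s : Fin T, ENNReal.ofReal (P.gap p.1 (p.2 s).1) := by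
    intro T
    refine Finset.measurable_sum _ fun s _ => ?_
    have hs : Measurable fun p : O × History A T => (p.1, (p.2 s).1) := by fun_prop
    exact hg.comp hs
  induction T with
  | zero => simp
  | succ T ih =>
    have hc : Measurable fun p : O × O => ENNReal.ofReal (P.gap p.1 (P.opt p.2)) :=
      hg.comp (f := fun p : O × O => (p.1, P.opt p.2)) (by fun_prop)
    have hSh : ∀ h : History A T, Measurable fun θ : O =>
        ∑ s : Fin T, ENNReal.ofReal (P.gap θ (h s).1) := by
      intro h
      refine Finset.measurable_sum _ fun s _ => ?_
      exact hg.comp (measurable_prodMk_right (y := (h s).1))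
    have hin : Measurable fun h : History A T =>
        ∫⁻ θ, ∑ s : Fin T, ENNReal.ofReal (P.gap θ (h s).1) ∂(P.posterior T h) :=
      ((hS T).comp measurable_swap).lintegral_kernel_prod_right' (κ := P.posterior T)
    rw [Finset.sum_range_succ, ← ih, P.lintegral_law_succ T (hS (T + 1)),
      P.lintegral_law T (hS T), ← lintegral_add_left hin]
    refine lintegral_congr fun h => ?_
    rw [ofReal_condRegret hLip, ← lintegral_add_left (hSh h)]
    refine lintegral_congr fun θ => ?_
    simp only [Fin.sum_univ_castSucc, Fin.snoc_castSucc, Fin.snoc_last, lintegral_const,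
      measure_univ, mul_one]
    rw [lintegral_add_left measurable_const]
    simp

lemma expectedRegret_eq (hLip : ∀ θ, LipschitzWith L (fun a => P.meanReward a θ)) (T : ℕ) :
    P.expectedRegret T
      = (∑ t ∈ Finset.range T,
          ∫⁻ h, ENNReal.ofReal (P.condRegret h) ∂(P.historyLaw t)).toReal := by
  have hS : Measurable fun p : O × History A T => ∑ s : Fin T, P.gap p.1 (p.2 s).1 := by
    refine Finset.measurable_sum _ fun s _ => ?_
    have hs : Measurable fun p : O × History A T => (p.1, (p.2 s).1) := by fun_prop
    exact P.measurable_gap.comp hs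
  rw [← lintegral_sum_gap hLip]
  change ∫ p : O × History A T, ∑ s : Fin T, P.gap p.1 (p.2 s).1 ∂_ = _
  rw [integral_eq_lintegral_of_nonneg_ae
    (.of_forall fun p => Finset.sum_nonneg fun s _ => P.gap_nonneg _ _) hS.aestronglyMeasurable]
  congr 1
  refine lintegral_congr fun p => ?_
  exact ENNReal.ofReal_sum_of_nonneg fun s _ => P.gap_nonneg _ _

lemma expectedRegret_le_of_isCompressedTS
    (hLip : ∀ θ, LipschitzWith L (fun a => P.meanReward a θ)) (hq : Measurable q)
    {T : ℕ} {ε : ℝ} (hε : 0 ≤ ε) {φ : (t : ℕ) → Kernel (History A t × Fin K) A}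
    (hφ : P.IsCompressedTS q T ε φ) {Γ : ℝ} (hΓ : 0 < Γ)
    (h : P.avgInfoRatio q T φ ≤ ENNReal.ofReal Γ) :
    P.expectedRegret T ≤ √(Γ * T * Real.log K) + ε * T := by
  have hlogK : 0 ≤ Real.log K := Real.log_natCast_nonneg K
  have hround : ∀ l : ℝ, 0 < l → ∀ t < T,
      ∫⁻ h, ENNReal.ofReal (P.condRegret h) ∂(P.historyLaw t)
        ≤ ENNReal.ofReal ε
          + (ENNReal.ofReal (l / 2) * ∫⁻ h, P.infoRatio q (φ t) h ∂(P.historyLaw t)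
            + ENNReal.ofReal (1 / (2 * l))
              * ∫⁻ h, P.condInfo q h (P.actionLaw h) ∂(P.historyLaw t)) := by
    intro l hl t ht
    have hJ := P.aemeasurable_condInfo_actionLaw q hq t
    -- These rewrites require measurability of the information term only, not of `infoRatio`: the
    -- constants are finite and the bound is linear in the ratio. This is where AM-GM at fixed `l`
    -- replaces Cauchy-Schwarz.
    rw [← lintegral_const_mul' _ _ ENNReal.ofReal_ne_top,
      ← lintegral_const_mul' _ _ ENNReal.ofReal_ne_top,
      ← lintegral_add_right' _ (hJ.const_mul _)]
    have hconst : ENNReal.ofReal ε = ∫⁻ _, ENNReal.ofReal ε ∂(P.historyLaw t) := by simp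
    rw [hconst, ← lintegral_add_left measurable_const]
    refine lintegral_mono_ae ?_
    filter_upwards [hφ.regret_le t ht, hφ.info_le t ht, P.ae_condInfo_actionLaw_ne_top q hq t]
      with h h1 h2 h3
    refine (ENNReal.ofReal_le_ofReal h1).trans (ENNReal.ofReal_add_le.trans ?_)
    gcongr
    exact ofReal_le_mul_ratio_add_mul hl h2 h3
  have hbound : ∀ l : ℝ, 0 < l →
      P.expectedRegret T - ε * T ≤ l / 2 * (Γ * T) + 1 / (2 * l) * Real.log K := by
    intro l hl
    have hsum : ∑ t ∈ Finset.range T, ∫⁻ h, ENNReal.ofReal (P.condRegret h) ∂(P.historyLaw t)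
        ≤ ENNReal.ofReal (ε * T + (l / 2 * (Γ * T) + 1 / (2 * l) * Real.log K)) := by
      refine (Finset.sum_le_sum fun t ht => hround l hl t (Finset.mem_range.1 ht)).trans ?_
      rw [Finset.sum_add_distrib, Finset.sum_add_distrib, ← Finset.mul_sum, ← Finset.mul_sum,
        ENNReal.ofReal_add (by positivity) (by positivity),
        ENNReal.ofReal_add (by positivity) (by positivity),
        ENNReal.ofReal_mul (p := l / 2) (by positivity),
        ENNReal.ofReal_mul (p := 1 / (2 * l)) (by positivity)]
      gcongr
      · rw [Finset.sum_const, Finset.card_range, nsmul_eq_mul, mul_comm,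
          ENNReal.ofReal_mul hε, ENNReal.ofReal_natCast]
      · rw [mul_comm Γ]
        exact sum_lintegral_infoRatio_le h
      · exact P.sum_lintegral_condInfo_le q hq T
    have := ENNReal.toReal_mono ENNReal.ofReal_ne_top hsum
    rw [← expectedRegret_eq hLip, ENNReal.toReal_ofReal (by positivity)] at this
    linarith
  have := le_sqrt_mul_of_forall_pos (by positivity) hlogK hbound
  linarith

lemma isCompressedTS_cellActionKernel
    (hLip : ∀ θ, LipschitzWith L (fun a => P.meanReward a θ)) (hq : Measurable q) (T : ℕ) {ε : ℝ}
    (hε : P.CellPrecision q ε) : P.IsCompressedTS q T ε (P.cellActionKernel hq) where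
  markov _ _ := inferInstance
  info_le t _ := .of_forall fun h => by rw [compressedActionLaw_cellActionKernel]
  regret_le t _ := .of_forall fun h => by
    let η : Kernel O A := (P.cellActionKernel hq t).comap (fun θ => (h, q (P.opt θ)))
      (measurable_const.prodMk (P.measurable_cell_opt hq))
    have hη : IsMarkovKernel η := Kernel.IsMarkovKernel.comap _ _
    have hint1 := integrable_integral_gap hLip (Kernel.const O (P.actionLaw h)) (P.posterior t h)
    have hint2 := integrable_integral_gap hLip η (P.posterior t h)
    -- The compressed action has the law of `Â`, so the two regrets differ exactly by the expected
    -- gap of an action resampled in the cell of `A⋆`.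
    have hcomp : P.compressedRegret q (P.cellActionKernel hq t) h
        = P.condRegret h - ∫ θ, ∫ a, P.gap θ a ∂(η θ) ∂(P.posterior t h) := by
      rw [condRegret_eq hLip, compressedRegret, compressedActionLaw_cellActionKernel]
      refine Eq.trans ?_ (integral_sub hint1 hint2)
      refine integral_congr_ae (.of_forall fun θ => ?_)
      have h1 := sub_integral_meanReward hLip θ (P.actionLaw h)
      have h2 := sub_integral_meanReward hLip θ (η θ)
      simp only [← h1, ← h2]
      simp only [η, Kernel.comap_apply]
      ring
    -- Probability matching: `actionLaw h` is also the posterior law of `A⋆`, so the cell of `A⋆`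
    -- almost surely has positive mass and the fallback branch is not used.
    have hpos : ∀ᵐ θ ∂(P.posterior t h), P.actionLaw h (q ⁻¹' {q (P.opt θ)}) ≠ 0 := by
      have : ∀ᵐ k ∂((P.posterior t h).map fun θ => q (P.opt θ)),
          P.actionLaw h (q ⁻¹' {k}) ≠ 0 := by
        rw [ae_iff_of_countable]
        intro k hk
        rw [Measure.map_apply (P.measurable_cell_opt hq) (measurableSet_singleton k)] at hk
        rwa [actionLaw, Measure.map_apply P.opt_measurable (hq (measurableSet_singleton k))]
      exact ae_of_ae_map (P.measurable_cell_opt hq).aemeasurable this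
    have hle : ∫ θ, ∫ a, P.gap θ a ∂(η θ) ∂(P.posterior t h) ≤ ε := by
      have : ∫ θ, ∫ a, P.gap θ a ∂(η θ) ∂(P.posterior t h) ≤ ∫ _, ε ∂(P.posterior t h) := by
        refine integral_mono_ae hint2 (integrable_const ε) ?_
        filter_upwards [hpos] with θ hθ
        have hcell : ∀ᵐ a ∂(η θ), q a = q (P.opt θ) := by
          simp only [η, Kernel.comap_apply]
          rw [cellActionKernel_apply hq hθ]
          exact ae_cond_mem (hq (measurableSet_singleton _))
        have : ∫ a, P.gap θ a ∂(η θ) ≤ ∫ _, ε ∂(η θ) := by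
          refine integral_mono_ae
            (integrable_gap hLip _ (f := fun a => (θ, a)) measurable_prodMk_left)
            (integrable_const ε) ?_
          filter_upwards [hcell] with a ha using hε θ a ha
        simpa using this
      simpa using this
    linarith

end Lipschitz

end BanditProblem

theorem mainTheorem3 {A O : Type*}
    [MetricSpace A] [CompactSpace A] [MeasurableSpace A] [BorelSpace A]
    [MeasurableSpace O] [StandardBorelSpace O] [Nonempty O]
    (P : BanditProblem A O) (L : ℝ≥0)
    (hLip : ∀ θ, LipschitzWith L (fun a => P.meanReward a θ))
    (T : ℕ) (ϵ : ℝ≥0) {K : ℕ} (c : Fin K → A) (q : A → Fin K)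
    (hq : IsMinimalQuantization ϵ c q) :
    (∀ φ : (t : ℕ) → Kernel (History A t × Fin K) A, P.IsCompressedTS q T (L * ϵ) φ →
      ∀ Γ : ℝ, 0 < Γ → P.avgInfoRatio q T φ ≤ ENNReal.ofReal Γ →
        P.expectedRegret T ≤
          √(Γ * T * Real.log (Metric.coveringNumber ϵ (Set.univ : Set A)).toNat) + L * ϵ * T) ∧
    (P.CellPrecision q (L * ϵ) →
      ∃ φ : (t : ℕ) → Kernel (History A t × Fin K) A, P.IsCompressedTS q T (L * ϵ) φ) ∧
    (∃ φ : (t : ℕ) → Kernel (History A t × Fin K) A, P.IsCompressedTS q T (2 * L * ϵ) φ) ∧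
    (∀ φ : (t : ℕ) → Kernel (History A t × Fin K) A, P.IsCompressedTS q T (2 * L * ϵ) φ →
      ∀ Γ : ℝ, 0 < Γ → P.avgInfoRatio q T φ ≤ ENNReal.ofReal Γ →
        P.expectedRegret T ≤
          √(Γ * T * Real.log (Metric.coveringNumber ϵ (Set.univ : Set A)).toNat)
            + 2 * L * ϵ * T) := by
  have hK : (Metric.coveringNumber ϵ (Set.univ : Set A)).toNat = K := by simp [hq.card_eq]
  rw [hK]
  exact ⟨fun φ hφ Γ hΓ h => BanditProblem.expectedRegret_le_of_isCompressedTS hLip hq.measurable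
      (by positivity) hφ hΓ h,
    fun h => ⟨_, BanditProblem.isCompressedTS_cellActionKernel hLip hq.measurable T h⟩,
    ⟨_, BanditProblem.isCompressedTS_cellActionKernel hLip hq.measurable T
      (BanditProblem.cellPrecision_two_mul hLip hq.dist_le)⟩,
    fun φ hφ Γ hΓ h => BanditProblem.expectedRegret_le_of_isCompressedTS hLip hq.measurable
      (by positivity) hφ hΓ h⟩
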